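/- Let $\mathcal H_A,\mathcal H_B$ be complex Hilbert spaces (of arbitrary dimension, not necessarily separable) and $\mathcal H_{AB}=\mathcal H_A\otimes\mathcal H_B$ their Hilbert space tensor product. For $\tau\in\mathcal H_{AB}$ and $a\in\mathcal H_A$ let $\tau^{|a}\in\mathcal H_B$ be the conditional vector, i.e. $\tau\mapsto\tau^{|a}$ is the bounded linear map with $(v\otimes w)^{|a}=\langle a,v\rangle\, w$. A one-way LOCC binary discrimination protocol (from Alice to Bob) consists of a family of bounded operators $E^{(i)}\ge 0$ on $\mathcal H_A$ with $\sum_i E^{(i)}=\mathbb 1_A$ and, for each $i$, an operator $F^{(i)}$ on $\mathcal H_B$ with $0\le F^{(i)}\le\mathbb 1_B$; its operator is $M=\sum_i E^{(i)}\otimes F^{(i)}$ (sums in the strong operator topology), which satisfies $0\le M\le \mathbb 1_{AB}$. It perfectly discriminates between two states $\rho,\sigma$ on $\mathcal H_{AB}$ if $|\operatorname{tr}(M(\rho-\sigma))|=1$. **Theorem.** For every pair of orthogonal unit vectors $\psi,\phi\in\mathcal H_{AB}$ there exists a one-way LOCC binary discrimination protocol that perfectly discriminates between the pure states $|\psi\rangle\langle\psi|$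 and $|\phi\rangle\langle\phi|$. Moreover, the protocol can be chosen so that Alice measures in an orthonormal basis $(e_i)_i$ of $\mathcal H_A$, that is $E^{(i)}=|e_i\rangle\langle e_i|$, for which Bob's conditional vectors satisfy $\langle\phi^{|e_i},\psi^{|e_i}\rangle=0$ for every $i$. -/

import Mathlib

open scoped TensorProduct InnerProductSpace
open InnerProductSpace

universe u v w

noncomputable section

/-- The Hilbert space tensor product `H_A ⊗ H_B`: the completion of the algebraic tensor product
with respect to the inner product `⟪a ⊗ b, a' ⊗ b'⟫ = ⟪a, a'⟫ * ⟪b, b'⟫`. -/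
abbrev HilbertTensor (HA : Type u) (HB : Type v)
    [NormedAddCommGroup HA] [InnerProductSpace ℂ HA]
    [NormedAddCommGroup HB] [InnerProductSpace ℂ HB] : Type (max u v) :=
  UniformSpace.Completion (HA ⊗[ℂ] HB)

section Operators

variable {HA : Type u} {HB : Type v}
  [NormedAddCommGroup HA] [InnerProductSpace ℂ HA]
  [NormedAddCommGroup HB] [InnerProductSpace ℂ HB]

/-- The bounded operator `E ⊗ F` on `H_A ⊗ H_B`, i.e. the continuous extension of
`a ⊗ b ↦ E a ⊗ F b`. -/
def tensorOp (E : HA →L[ℂ] HA) (F : HB →L[ℂ] HB) :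
    HilbertTensor HA HB →L[ℂ] HilbertTensor HA HB :=
  (TensorProduct.mapL E F).completion

/-- For `a : H_A`, the map `τ ↦ τ^{|a}` from `H_A ⊗ H_B` to `H_B`: the continuous linear extension
of `v ⊗ w ↦ ⟪a, v⟫ • w`. The vector `condState a τ` is the (unnormalized) state of the second
system conditioned on the outcome `a` of a measurement of the first. -/
def condState [CompleteSpace HB] (a : HA) : HilbertTensor HA HB →L[ℂ] HB :=
  (((TensorProduct.lidIsometry ℂ HB).toContinuousLinearEquiv : (ℂ ⊗[ℂ] HB) →L[ℂ] HB) ∘L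
      (innerSL ℂ a).rTensor HB).extend
    (UniformSpace.Completion.toComplL : (HA ⊗[ℂ] HB) →L[ℂ] HilbertTensor HA HB)

/-- The pure state `|ψ⟩⟨ψ|`. -/
def pureState {H : Type w} [NormedAddCommGroup H] [InnerProductSpace ℂ H] (ψ : H) : H →L[ℂ] H :=
  rankOne ℂ ψ ψ

/-- The bounded operator `T` on a Hilbert space is trace class, with trace `t`: in every orthonormal
basis its diagonal entries are (absolutely) summable, with sum `t`. -/
def HasTrace {H : Type w} [NormedAddCommGroup H] [InnerProductSpace ℂ H]
    (T : H →L[ℂ] H) (t : ℂ) : Prop :=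
  ∀ (κ : Type w) (b : HilbertBasis κ ℂ H), HasSum (fun k => ⟪b k, T (b k)⟫_ℂ) t

/-- A binary discrimination protocol on a Hilbert space, given by an operator `M` with
`0 ≤ M ≤ 1` (the effect of the first of the two outcomes). -/
def IsBinaryDiscrimination {H : Type w} [NormedAddCommGroup H] [InnerProductSpace ℂ H]
    (M : H →L[ℂ] H) : Prop :=
  0 ≤ M ∧ M ≤ 1

/-- The binary discrimination protocol `M` perfectly discriminates between the states `ρ` and `σ`:
`|tr (M (ρ - σ))| = 1`. -/
def PerfectlyDiscriminates {H : Type w} [NormedAddCommGroup H] [InnerProductSpace ℂ H]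
    (M ρ σ : H →L[ℂ] H) : Prop :=
  ∃ t : ℂ, HasTrace (M ∘L (ρ - σ)) t ∧ ‖t‖ = 1

end Operators

/-- A one-way LOCC binary discrimination protocol (from Alice to Bob), where Alice's measurement has
outcome set `ι`: Alice performs the measurement `(E i)` on her system and sends the outcome `i` to
Bob, who performs the two-outcome measurement `(F i, 1 - F i)` on his and announces his guess.
The effects `E i` sum to the identity in the strong operator topology. -/
structure OneWayLOCC (ι : Type w) (HA : Type u) (HB : Type v)
    [NormedAddCommGroup HA] [InnerProductSpace ℂ HA]
    [NormedAddCommGroup HB] [InnerProductSpace ℂ HB] where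
  /-- Alice's measurement. -/
  E : ι → HA →L[ℂ] HA
  /-- Bob's measurements. -/
  F : ι → HB →L[ℂ] HB
  E_nonneg : ∀ i, 0 ≤ E i
  E_sum : ∀ x, HasSum (fun i => E i x) x
  F_nonneg : ∀ i, 0 ≤ F i
  F_le_one : ∀ i, F i ≤ 1

/-- `M = ∑ i, E i ⊗ F i`, with convergence in the strong operator topology. -/
def OneWayLOCC.HasOperator {ι : Type w} {HA : Type u} {HB : Type v}
    [NormedAddCommGroup HA] [InnerProductSpace ℂ HA]
    [NormedAddCommGroup HB] [InnerProductSpace ℂ HB]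
    (P : OneWayLOCC ι HA HB) (M : HilbertTensor HA HB →L[ℂ] HilbertTensor HA HB) : Prop :=
  ∀ x, HasSum (fun i => tensorOp (P.E i) (P.F i) x) (M x)

end

/-! Expanding in an orthonormal basis `e` of Alice's space, the numbers ⟪φ^{|e_i}, ψ^{|e_i}⟫ are the
diagonal of the form `condForm φ ψ`, and they sum to ⟪φ, ψ⟫ = 0 whatever the basis. So the task is
to find a basis in which a form of trace zero has zero diagonal
(`exists_hilbertBasis_apply_self_eq_zero`).

Zorn gives a maximal orthonormal set `s` of zeros of the diagonal. If `s` were not a basis up to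
further zeros, the numerical range on its orthogonal complement would be a nonempty convex set
(Toeplitz–Hausdorff) avoiding 0, hence inside a closed half-plane. Nonnegative terms with sum zero
vanish, so the range lies on the boundary line; avoiding 0, it lies on one open ray of that line,
and the same argument on this ray is a contradiction.

Given the basis, Bob tests for the normalized ψ^{|e_i}. The resulting `M` is the projection onto the
closed span of the e_i ⊗ u_i, which fixes ψ and kills φ. -/

/-! ### Convexity of the numerical range. -/

section NumericalRange

/-- A convex set of complex numbers that avoids the origin lies in a closed half-plane. -/
theorem Convex.exists_half_plane {s : Set ℂ} (hs : Convex ℝ s) (h0 : (0 : ℂ) ∉ s) :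
    ∃ c : ℂ, c ≠ 0 ∧ ∀ w ∈ s, 0 ≤ (c * w).re := by
  -- Compactness of the unit circle reduces the claim to finitely many points, whose convex hull is
  -- compact and can be strictly separated from 0.
  have key := (isCompact_sphere (0 : ℂ) 1).inter_iInter_nonempty
    (fun w : s => {c : ℂ | 0 ≤ (c * (w : ℂ)).re})
    (fun w => isClosed_le continuous_const (by fun_prop)) ?_
  · obtain ⟨c, hc, hcw⟩ := key
    refine ⟨c, ?_, fun w hw => ?_⟩
    · rintro rfl
      simp at hc
    · exact Set.mem_iInter.1 hcw ⟨w, hw⟩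
  · intro t
    set F : Set ℂ := (fun w : s => (w : ℂ)) '' (t : Set s) with hF
    have hFfin : F.Finite := t.finite_toSet.image _
    have hFs : F ⊆ s := by
      rintro _ ⟨w, -, rfl⟩
      exact w.2
    have hcl : IsClosed (convexHull ℝ F) := (hFfin.isCompact_convexHull ℝ).isClosed
    obtain ⟨f, r, hf0, hf⟩ := RCLike.geometric_hahn_banach_point_closed (𝕜 := ℂ)
      (convex_convexHull ℝ F) hcl (fun h => h0 (convexHull_min hFs hs h))
    have hfz : ∀ z, f z = f 1 * z := fun z => by
      have := f.map_smul z 1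
      simpa [mul_comm] using this
    by_cases hf1 : f 1 = 0
    · refine ⟨1, by simp, Set.mem_iInter₂.2 fun w hw => ?_⟩
      have h1 := hf w (subset_convexHull ℝ F ⟨w, hw, rfl⟩)
      rw [hfz, hf1] at h1 hf0
      simp at h1 hf0
      linarith
    · refine ⟨((‖f 1‖⁻¹ : ℝ) : ℂ) * f 1, ?_, Set.mem_iInter₂.2 fun w hw => ?_⟩
      · simp [hf1]
      · have h1 := hf w (subset_convexHull ℝ F ⟨w, hw, rfl⟩)
        have h2 : 0 ≤ (f 1 * (w : ℂ)).re := by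
          rw [← hfz]
          simp at hf0 h1
          linarith
        change 0 ≤ (((‖f 1‖⁻¹ : ℝ) : ℂ) * f 1 * (w : ℂ)).re
        rw [mul_assoc, Complex.re_ofReal_mul]
        positivity

/-- A phase `e` makes `e * a + conj e * b` a real number `r`. With `z = t * e` the equation becomes
`1 + t * r - t ^ 2 = 0`, whose discriminant `r ^ 2 + 4` is positive. -/
theorem exists_quadratic_root (a b : ℂ) :
    ∃ z : ℂ, 1 + z * a + (starRingEnd ℂ) z * b - z * (starRingEnd ℂ) z = 0 := by
  obtain ⟨e, he, r, hr⟩ : ∃ e : ℂ, e * (starRingEnd ℂ) e = 1 ∧ ∃ r : ℝ,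
      e * a + (starRingEnd ℂ) e * b = r := by
    obtain ⟨e, he, hi⟩ : ∃ e : ℂ, e * (starRingEnd ℂ) e = 1 ∧
        (e * (a - (starRingEnd ℂ) b)).im = 0 := by
      by_cases hc : a - (starRingEnd ℂ) b = 0
      · exact ⟨1, by simp, by simp [hc]⟩
      · set c := a - (starRingEnd ℂ) b
        have hn : ((‖c‖ : ℝ) : ℂ) ≠ 0 := by simpa using hc
        refine ⟨(starRingEnd ℂ) c / (‖c‖ : ℝ), ?_, ?_⟩
        · simp only [map_div₀, Complex.conj_conj, Complex.conj_ofReal]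
          rw [div_mul_div_comm, mul_comm, Complex.mul_conj, Complex.normSq_eq_norm_sq]
          field_simp
          push_cast
          ring
        · rw [div_mul_eq_mul_div, mul_comm, Complex.mul_conj, ← Complex.ofReal_div]
          simp
    refine ⟨e, he, (e * a + (starRingEnd ℂ) e * b).re, ?_⟩
    apply Complex.ext
    · simp
    · simp at hi ⊢
      linarith
  have hs : 0 ≤ r ^ 2 + 4 := by positivity
  set t : ℝ := (r + √(r ^ 2 + 4)) / 2
  have ht : 1 + t * r - t * t = 0 := by
    have := Real.mul_self_sqrt hs
    simp only [t]
    nlinarith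
  refine ⟨t * e, ?_⟩
  have ht' : (1 : ℂ) + t * r - t * t = 0 := by exact_mod_cast ht
  simp only [map_mul, Complex.conj_ofReal]
  linear_combination ht' + (t : ℂ) * hr - (t : ℂ) * t * he

variable {E : Type u} [NormedAddCommGroup E] [InnerProductSpace ℂ E]

/-- Dividing the value of `B` at `x + c • y` by `B x x` gives the expression of
`exists_quadratic_root`. The vector is nonzero, as `x = -(c • y)` would force `(1 + |c|²) * B x x =
0`. -/
theorem LinearMap.exists_apply_self_eq_zero (B : E →ₗ⋆[ℂ] E →ₗ[ℂ] ℂ) (K : Submodule ℂ E) {x y : E}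
    (hx : x ∈ K) (hy : y ∈ K) (hB : B x x ≠ 0) (hxy : B y y = -B x x) :
    ∃ z ∈ K, z ≠ 0 ∧ B z z = 0 := by
  obtain ⟨c, hc⟩ := exists_quadratic_root (B x y / B x x) (B y x / B x x)
  have hz : B (x + c • y) (x + c • y) = 0 := by
    simp only [map_add, map_smulₛₗ, LinearMap.add_apply, LinearMap.smul_apply, smul_eq_mul,
      RingHom.id_apply, hxy]
    field_simp at hc
    linear_combination hc
  refine ⟨x + c • y, K.add_mem hx (K.smul_mem c hy), fun h => ?_, hz⟩
  have h1 : x = -(c • y) := eq_neg_of_add_eq_zero_left h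
  have h2 : B x x = c * (starRingEnd ℂ) c * B y y := by
    conv_lhs => rw [h1]
    simp
    ring
  rw [hxy, Complex.mul_conj] at h2
  have h3 : ((1 + Complex.normSq c : ℝ) : ℂ) * B x x = 0 := by
    push_cast
    linear_combination h2
  have h4 : (1 + Complex.normSq c : ℝ) ≠ 0 := by
    have := Complex.normSq_nonneg c
    positivity
  rcases mul_eq_zero.1 h3 with h | h
  · exact h4 (by exact_mod_cast h)
  · exact hB h

/-- The **Toeplitz–Hausdorff theorem** for the compression of a sesquilinear form to a subspace. -/
theorem LinearMap.convex_numericalRange (B : E →ₗ⋆[ℂ] E →ₗ[ℂ] ℂ) (K : Submodule ℂ E) :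
    Convex ℝ {l : ℂ | ∃ x ∈ K, ‖x‖ = 1 ∧ B x x = l} := by
  rintro _ ⟨x, hx, hx1, rfl⟩ _ ⟨y, hy, hy1, rfl⟩ s t hs ht hst
  rcases eq_or_lt_of_le hs with rfl | hs
  · exact ⟨y, hy, hy1, by simp [show t = 1 by linarith]⟩
  rcases eq_or_lt_of_le ht with rfl | ht
  · exact ⟨x, hx, hx1, by simp [show s = 1 by linarith]⟩
  by_cases hd : B x x = B y y
  · refine ⟨x, hx, hx1, ?_⟩
    rw [← hd, ← add_smul, hst, one_smul]
  set l : ℂ := s • B x x + t • B y y with hl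
  have hl' : l = s * B x x + t * B y y := by simp [hl]
  -- Unit vectors where `B` takes the value `l` are the normalized zeros of `B'`. On the diagonal
  -- `B'` equals `t * (B x x - B y y)` at `x` and `-s * (B x x - B y y)` at `y`; rescaling by `1 /
  -- √t` and `1 / √s` makes the two values opposite.
  set B' : E →ₗ⋆[ℂ] E →ₗ[ℂ] ℂ := B - l • innerₛₗ ℂ with hB'
  have hB'z : ∀ z, B' z z = B z z - l * (‖z‖ : ℂ) ^ 2 := fun z => by
    simp [hB', inner_self_eq_norm_sq_to_K]
  have hst' : (s : ℂ) + t = 1 := by exact_mod_cast hst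
  have hsC : (s : ℂ) ≠ 0 := by exact_mod_cast hs.ne'
  have htC : (t : ℂ) ≠ 0 := by exact_mod_cast ht.ne'
  have hsc : ∀ (r : ℝ) (z : E), 0 < r → ‖z‖ = 1 →
      B' (((√r)⁻¹ : ℂ) • z) (((√r)⁻¹ : ℂ) • z) = (r : ℂ)⁻¹ * (B z z - l) := by
    intro r z hr hz
    have : ((√r : ℂ)) * √r = r := by exact_mod_cast Real.mul_self_sqrt hr.le
    simp only [map_smulₛₗ, LinearMap.smul_apply, smul_eq_mul, RingHom.id_apply, hB'z, hz,
      map_inv₀, Complex.conj_ofReal, ← this, mul_inv]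
    simp
    ring
  have e1 : B' (((√t)⁻¹ : ℂ) • x) (((√t)⁻¹ : ℂ) • x) = B x x - B y y := by
    rw [hsc t x ht hx1, hl', inv_mul_eq_iff_eq_mul₀ htC]
    linear_combination (-B x x) * hst'
  have e2 : B' (((√s)⁻¹ : ℂ) • y) (((√s)⁻¹ : ℂ) • y) = -(B x x - B y y) := by
    rw [hsc s y hs hy1, hl', inv_mul_eq_iff_eq_mul₀ hsC]
    linear_combination (-B y y) * hst'
  obtain ⟨z, hz, hz0, hzz⟩ := B'.exists_apply_self_eq_zero K (K.smul_mem _ hx) (K.smul_mem _ hy)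
    (by rw [e1]; exact sub_ne_zero.2 hd) (by rw [e1, e2])
  rw [hB'z] at hzz
  have hzn : (‖z‖ : ℂ) ≠ 0 := by simpa using hz0
  refine ⟨((‖z‖⁻¹ : ℝ) : ℂ) • z, K.smul_mem _ hz, ?_, ?_⟩
  · rw [norm_smul]
    simp [hz0]
  · simp only [map_smulₛₗ, LinearMap.smul_apply, smul_eq_mul, RingHom.id_apply,
      Complex.conj_ofReal]
    push_cast
    field_simp
    linear_combination hzz

theorem Orthonormal.insert_of_inner_eq_zero {s : Set E} (hs : Orthonormal ℂ ((↑) : s → E)) {z : E}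
    (hz : ‖z‖ = 1) (h : ∀ x ∈ s, ⟪x, z⟫_ℂ = 0) :
    Orthonormal ℂ (Subtype.val : ↥(insert z s) → E) := by
  constructor
  · rintro ⟨x, rfl | hx⟩
    · exact hz
    · exact hs.1 ⟨x, hx⟩
  · rintro ⟨x, hx⟩ ⟨y, hy⟩ hxy
    simp only [ne_eq, Subtype.mk.injEq] at hxy
    change ⟪x, y⟫_ℂ = 0
    rcases hx with rfl | hx <;> rcases hy with rfl | hy
    · exact absurd rfl hxy
    · exact inner_eq_zero_symm.1 (h y hy)
    · exact h x hx
    · exact hs.2 (i := ⟨x, hx⟩) (j := ⟨y, hy⟩) (by simpa using hxy)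

/-! ### Orthonormal bases with zero diagonal. -/

variable [CompleteSpace E]

/-- In a Hilbert basis extending `s ∪ {z}`, the real parts of the diagonal of `c * B` are
nonnegative and sum to zero, so each vanishes, in particular the one at `z`. -/
theorem re_apply_self_eq_zero_of_nonneg (B : E →ₗ⋆[ℂ] E →ₗ[ℂ] ℂ)
    (hB : ∀ (w : Set E) (b : HilbertBasis w ℂ E), HasSum (fun i => B (b i) (b i)) 0)
    {s : Set E} (hs : Orthonormal ℂ ((↑) : s → E)) (hs0 : ∀ x ∈ s, B x x = 0) (c : ℂ)
    (hc : ∀ z, (∀ x ∈ s, ⟪x, z⟫_ℂ = 0) → ‖z‖ = 1 → 0 ≤ (c * B z z).re)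
    {z : E} (hz : ∀ x ∈ s, ⟪x, z⟫_ℂ = 0) (hz1 : ‖z‖ = 1) : (c * B z z).re = 0 := by
  obtain ⟨w, b, hw, hb⟩ := (hs.insert_of_inner_eq_zero hz1 hz).exists_hilbertBasis_extension
  have h1 := Complex.hasSum_re ((hB w b).mul_left c)
  simp only [mul_zero, Complex.zero_re] at h1
  have hnn : ∀ i, 0 ≤ (c * B (b i) (b i)).re := by
    intro i
    by_cases hi : b i ∈ s
    · simp [hs0 _ hi]
    · refine hc _ (fun x hx => ?_) (b.orthonormal.1 i)
      have hxw : x ∈ w := hw (Set.mem_insert_of_mem _ hx)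
      have hx' : b ⟨x, hxw⟩ = x := by rw [hb]
      rw [← hx']
      refine b.orthonormal.2 fun h => hi ?_
      rw [← h, hx']
      exact hx
  have h2 := (hasSum_zero_iff_of_nonneg hnn).1 h1
  have h3 := congrFun h2 ⟨z, hw (Set.mem_insert _ _)⟩
  simpa [hb] using h3

/-- A sesquilinear form whose diagonal sums to zero in every orthonormal basis vanishes on the
diagonal of some orthonormal basis. -/
theorem exists_hilbertBasis_apply_self_eq_zero (B : E →ₗ⋆[ℂ] E →ₗ[ℂ] ℂ)
    (hB : ∀ (w : Set E) (b : HilbertBasis w ℂ E), HasSum (fun i => B (b i) (b i)) 0) :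
    ∃ (w : Set E) (b : HilbertBasis w ℂ E), ∀ i, B (b i) (b i) = 0 := by
  obtain ⟨s, hs⟩ := zorn_subset {s : Set E | Orthonormal ℂ ((↑) : s → E) ∧ ∀ x ∈ s, B x x = 0} (by
    intro C hC hchain
    refine ⟨⋃₀ C, ⟨?_, ?_⟩, fun s hs => Set.subset_sUnion_of_mem hs⟩
    · exact orthonormal_sUnion_of_directed hchain.directedOn fun a ha => (hC ha).1
    · rintro x ⟨a, ha, hx⟩
      exact (hC ha).2 x hx)
  obtain ⟨hso, hs0⟩ := hs.prop
  obtain ⟨w, b, hw, hb⟩ := hso.exists_hilbertBasis_extension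
  refine ⟨w, b, ?_⟩
  by_contra! hne
  obtain ⟨i, hi⟩ := hne
  set z₀ := b i with hz₀
  have hz₀1 : ‖z₀‖ = 1 := b.orthonormal.1 i
  have hz₀s : ∀ x ∈ s, ⟪x, z₀⟫_ℂ = 0 := by
    intro x hx
    have hx' : b ⟨x, hw hx⟩ = x := by rw [hb]
    rw [← hx']
    refine b.orthonormal.2 fun h => hi ?_
    rw [hz₀, ← h, hx']
    exact hs0 x hx
  -- By maximality a zero orthogonal to `s` would belong to `s`, hence be orthogonal to itself.
  have hnz : ∀ z, (∀ x ∈ s, ⟪x, z⟫_ℂ = 0) → ‖z‖ = 1 → B z z ≠ 0 := by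
    intro z hz hz1 hzz
    have hmem : z ∈ s := hs.mem_of_prop_insert ⟨hso.insert_of_inner_eq_zero hz1 hz, by
      rintro x (rfl | hx)
      · exact hzz
      · exact hs0 x hx⟩
    have := hz z hmem
    rw [inner_self_eq_zero] at this
    simp [this] at hz1
  let K : Submodule ℂ E := (Submodule.span ℂ s)ᗮ
  have hK : ∀ z, z ∈ K ↔ ∀ x ∈ s, ⟪x, z⟫_ℂ = 0 := fun z => by
    refine ⟨fun h x hx => h x (Submodule.subset_span hx), fun h => ?_⟩
    rw [Submodule.mem_orthogonal]
    intro x hx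
    induction hx using Submodule.span_induction with
    | mem x hx => exact h x hx
    | zero => simp
    | add x y _ _ hx hy => rw [inner_add_left, hx, hy, add_zero]
    | smul a x _ hx => rw [inner_smul_left, hx, mul_zero]
  have hconv := B.convex_numericalRange K
  have h0 : (0 : ℂ) ∉ {l : ℂ | ∃ x ∈ K, ‖x‖ = 1 ∧ B x x = l} := by
    rintro ⟨x, hx, hx1, hxx⟩
    exact hnz x ((hK x).1 hx) hx1 hxx
  obtain ⟨c, hc0, hc⟩ := hconv.exists_half_plane h0
  have hre : ∀ z, (∀ x ∈ s, ⟪x, z⟫_ℂ = 0) → ‖z‖ = 1 → (c * B z z).re = 0 := fun z hz hz1 =>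
    re_apply_self_eq_zero_of_nonneg B hB hso hs0 c
      (fun y hy hy1 => hc _ ⟨y, (hK y).2 hy, hy1, rfl⟩) hz hz1
  have him : ∀ z, (∀ x ∈ s, ⟪x, z⟫_ℂ = 0) → ‖z‖ = 1 → (c * B z z).im ≠ 0 := fun z hz hz1 h =>
    (mul_ne_zero hc0 (hnz z hz hz1)) (Complex.ext (hre z hz hz1) h)
  set r := (c * B z₀ z₀).im with hr
  have hr0 : r ≠ 0 := him z₀ hz₀s hz₀1
  -- The values `c * B z z` are purely imaginary and nonzero. If two had opposite signs, the convex
  -- combination of `r` and `m` that equals 0 would be attained too.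
  have hsign : ∀ z, (∀ x ∈ s, ⟪x, z⟫_ℂ = 0) → ‖z‖ = 1 → 0 ≤ r * (c * B z z).im := by
    intro z hz hz1
    by_contra! hneg
    set m := (c * B z z).im with hm
    have hd : 0 < r ^ 2 - r * m := by nlinarith [sq_nonneg r]
    have hrr : 0 < r ^ 2 := by positivity
    obtain ⟨y, hy, hy1, hyy⟩ := hconv ⟨z₀, (hK z₀).2 hz₀s, hz₀1, rfl⟩ ⟨z, (hK z).2 hz, hz1, rfl⟩
      (a := -(r * m) / (r ^ 2 - r * m)) (b := r ^ 2 / (r ^ 2 - r * m))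
      (div_nonneg (by linarith) hd.le) (div_nonneg hrr.le hd.le)
      (by rw [← add_div, div_eq_one_iff_eq hd.ne']; ring)
    refine him y ((hK y).1 hy) hy1 ?_
    rw [hyy, mul_add, mul_smul_comm, mul_smul_comm, Complex.add_im, Complex.smul_im,
      Complex.smul_im, ← hr, ← hm, smul_eq_mul, smul_eq_mul]
    field_simp
    ring
  -- The factor `-I * r` turns the imaginary ray onto the positive real axis, so the positivity
  -- argument applies a second time.
  have hfin := re_apply_self_eq_zero_of_nonneg B hB hso hs0 (-Complex.I * r * c) (fun y hy hy1 => by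
    have := hsign y hy hy1
    have e : -Complex.I * r * c * B y y = (r : ℂ) * (-Complex.I * (c * B y y)) := by ring
    rw [e, Complex.re_ofReal_mul]
    simpa using this) hz₀s hz₀1
  have e : -Complex.I * r * c * B z₀ z₀ = (r : ℂ) * (-Complex.I * (c * B z₀ z₀)) := by ring
  rw [e, Complex.re_ofReal_mul] at hfin
  have : r * r = 0 := by
    rw [← hfin]
    congr 1
    simp [hr]
  exact hr0 (mul_self_eq_zero.1 this)

end NumericalRange

/-! ### Sums of rank one projections. -/

section OrthogonalProjection

variable {H : Type w} [NormedAddCommGroup H] [InnerProductSpace ℂ H]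

/-- The rank one projections along a family of pairwise orthogonal vectors, each of which is zero or
a unit vector, sum to a projection in the strong operator topology. -/
theorem exists_isStarProjection_hasSum_rankOne [CompleteSpace H] {ι : Type*} (v : ι → H)
    (hv : Pairwise fun i j => ⟪v i, v j⟫_ℂ = 0) (hv1 : ∀ i, v i = 0 ∨ ‖v i‖ = 1) :
    ∃ M : H →L[ℂ] H, IsStarProjection M ∧ ∀ x, HasSum (fun i => rankOne ℂ (v i) (v i) x) (M x) := by
  let J : Set ι := {i | v i ≠ 0}
  have ho : Orthonormal ℂ (fun i : J => v i) :=
    ⟨fun i => (hv1 i).resolve_left i.2, fun i j hij => hv fun h => hij (Subtype.ext h)⟩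
  set s : Set H := Set.range fun i : J => v i with hs
  obtain ⟨w, b, hw, hb⟩ := ho.toSubtypeRange.exists_hilbertBasis_extension
  set K : Submodule ℂ H := (Submodule.span ℂ s).topologicalClosure with hK
  have hKc : CompleteSpace K := (Submodule.isClosed_topologicalClosure _).completeSpace_coe
  have hsK : ∀ x ∈ s, x ∈ K := fun x hx =>
    Submodule.le_topologicalClosure _ (Submodule.subset_span hx)
  refine ⟨K.starProjection, isStarProjection_starProjection, fun x => ?_⟩
  -- The projection onto the closed span of the `v i` is applied to the expansion of `x` in a basis
  -- extending the nonzero `v i`: it fixes these and kills the other basis vectors.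
  have h1 := (b.hasSum_repr x).mapL K.starProjection
  let g : J → w := fun i => ⟨v i, hw ⟨i, rfl⟩⟩
  have hg : Function.Injective g := fun i j hij =>
    ho.linearIndependent.injective (congrArg Subtype.val hij)
  have h2 := (hg.hasSum_iff (f := fun k => K.starProjection (b.repr x k • b k))
    (a := K.starProjection x) ?_).2 h1
  · have h3 : HasSum ((fun i => rankOne ℂ (v i) (v i) x) ∘ ((↑) : J → ι)) (K.starProjection x) := by
      convert! h2 using 1
      funext i
      have e : b (g i) = v i := by rw [hb]
      simp only [Function.comp_apply, rankOne_apply, map_smul, b.repr_apply_apply, e]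
      rw [K.starProjection_eq_self_iff.2 (hsK _ ⟨i, rfl⟩)]
    refine (Subtype.val_injective.hasSum_iff fun i hi => ?_).1 h3
    have : v i = 0 := by
      by_contra h
      exact hi ⟨⟨i, h⟩, rfl⟩
    simp [this]
  · intro k hk
    rw [map_smul, K.starProjection_apply_eq_zero_iff.2, smul_zero]
    have hsub : Submodule.span ℂ s ≤ (ℂ ∙ b k)ᗮ := by
      rw [Submodule.span_le]
      rintro _ ⟨i, rfl⟩
      rw [SetLike.mem_coe, Submodule.mem_orthogonal_singleton_iff_inner_right]
      have e : b (g i) = v i := by rw [hb]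
      change ⟪b k, v i⟫_ℂ = 0
      rw [← e]
      exact b.orthonormal.2 fun h => hk ⟨i, h.symm⟩
    rw [hK, Submodule.orthogonal_closure]
    intro y hy
    exact (Submodule.mem_orthogonal_singleton_iff_inner_left.1 (hsub hy))

theorem hasTrace_pureState (ψ : H) : HasTrace (pureState ψ) ((‖ψ‖ : ℂ) ^ 2) := by
  intro κ b
  have h := b.hasSum_inner_mul_inner ψ ψ
  rw [inner_self_eq_norm_sq_to_K] at h
  convert! h using 2 with k
  simp [pureState]

end OrthogonalProjection

/-! ### Conditional vectors and expansions in the tensor product. -/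

section Conditional

variable {HA : Type u} {HB : Type v}
    [NormedAddCommGroup HA] [InnerProductSpace ℂ HA]
    [NormedAddCommGroup HB] [InnerProductSpace ℂ HB]

/-- The vector `a ⊗ w` of the Hilbert space tensor product. -/
noncomputable def HilbertTensor.tmul (a : HA) (w : HB) : HilbertTensor HA HB :=
  ((a ⊗ₜ[ℂ] w : HA ⊗[ℂ] HB) : UniformSpace.Completion (HA ⊗[ℂ] HB))

theorem HilbertTensor.inner_tmul (a a' : HA) (w w' : HB) :
    ⟪tmul a w, tmul a' w'⟫_ℂ = ⟪a, a'⟫_ℂ * ⟪w, w'⟫_ℂ := by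
  simp [tmul]

theorem HilbertTensor.norm_tmul (a : HA) (w : HB) : ‖tmul a w‖ = ‖a‖ * ‖w‖ := by
  simp [tmul]

theorem HilbertTensor.tmul_smul (a : HA) (c : ℂ) (w : HB) : tmul a (c • w) = c • tmul a w := by
  simp [tmul]

theorem HilbertTensor.tmul_zero (a : HA) : tmul a (0 : HB) = 0 := by
  simp [tmul]

/-- The isometry `w ↦ a ⊗ w` for a unit vector `a`. -/
noncomputable def HilbertTensor.tmulIsometry (a : HA) (ha : ‖a‖ = 1) :
    HB →ₗᵢ[ℂ] HilbertTensor HA HB where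
  toFun w := tmul a w
  map_add' w w' := by
    rw [tmul, TensorProduct.tmul_add, UniformSpace.Completion.coe_add]
    rfl
  map_smul' c w := by simp [tmul]
  norm_map' w := by
    change ‖tmul a w‖ = ‖w‖
    rw [norm_tmul, ha, one_mul]

theorem HilbertTensor.continuousLinearMap_ext {G : Type*} [NormedAddCommGroup G] [NormedSpace ℂ G]
    {f g : HilbertTensor HA HB →L[ℂ] G} (h : ∀ a w, f (tmul a w) = g (tmul a w)) : f = g := by
  ext x
  induction x using UniformSpace.Completion.induction_on with
  | hp => exact isClosed_eq f.continuous g.continuous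
  | ih t =>
    induction t using TensorProduct.induction_on with
    | zero => rw [UniformSpace.Completion.coe_zero, map_zero, map_zero]
    | tmul a w => exact h a w
    | add x y hx hy => rw [UniformSpace.Completion.coe_add, map_add, map_add, hx, hy]

open HilbertTensor

theorem tensorOp_tmul (E : HA →L[ℂ] HA) (F : HB →L[ℂ] HB) (a : HA) (w : HB) :
    tensorOp E F (tmul a w) = tmul (E a) (F w) := by
  simp [tensorOp, tmul]

theorem tensorOp_rankOne (a : HA) (w : HB) :
    tensorOp (rankOne ℂ a a) (rankOne ℂ w w) = rankOne ℂ (tmul a w) (tmul a w) := by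
  refine HilbertTensor.continuousLinearMap_ext fun a' w' => ?_
  rw [tensorOp_tmul, rankOne_apply, rankOne_apply, rankOne_apply, inner_tmul]
  rw [tmul, TensorProduct.smul_tmul_smul, UniformSpace.Completion.coe_smul]
  rfl

variable [CompleteSpace HB]

theorem condState_tmul (a v : HA) (w : HB) : condState a (tmul v w) = ⟪a, v⟫_ℂ • w := by
  unfold condState tmul
  have := ContinuousLinearMap.extend_eq
    (((TensorProduct.lidIsometry ℂ HB).toContinuousLinearEquiv : (ℂ ⊗[ℂ] HB) →L[ℂ] HB) ∘L
      (innerSL ℂ a).rTensor HB)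
    (e := (UniformSpace.Completion.toComplL : (HA ⊗[ℂ] HB) →L[ℂ] HilbertTensor HA HB))
    UniformSpace.Completion.denseRange_coe
    (UniformSpace.Completion.isUniformInducing_coe _) (v ⊗ₜ w)
  rw [UniformSpace.Completion.coe_toComplL] at this
  rw [this]
  simp

theorem inner_condState (a : HA) (w : HB) (x : HilbertTensor HA HB) :
    ⟪w, condState a x⟫_ℂ = ⟪tmul a w, x⟫_ℂ := by
  have : innerSL ℂ w ∘L condState a = innerSL ℂ (tmul a w) := by
    refine HilbertTensor.continuousLinearMap_ext fun a' w' => ?_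
    simp [condState_tmul, inner_tmul]
  exact DFunLike.congr_fun this x

theorem condState_add (a a' : HA) (x : HilbertTensor HA HB) :
    condState (a + a') x = condState a x + condState a' x := by
  have : (condState (a + a') : HilbertTensor HA HB →L[ℂ] HB) = condState a + condState a' := by
    refine HilbertTensor.continuousLinearMap_ext fun v w => ?_
    simp [condState_tmul, add_smul]
  rw [this]
  rfl

theorem condState_smul (c : ℂ) (a : HA) (x : HilbertTensor HA HB) :
    condState (c • a) x = (starRingEnd ℂ) c • condState a x := by
  have : (condState (c • a) : HilbertTensor HA HB →L[ℂ] HB) =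
      (starRingEnd ℂ) c • condState a := by
    refine HilbertTensor.continuousLinearMap_ext fun v w => ?_
    simp [condState_tmul, smul_smul, mul_comm]
  rw [this]
  rfl

theorem HilbertBasis.isHilbertSum_tmulIsometry {ι : Type*} (e : HilbertBasis ι ℂ HA) :
    IsHilbertSum ℂ (fun _ : ι => HB) fun i => tmulIsometry (e i) (e.orthonormal.1 i) := by
  refine IsHilbertSum.mk (fun i j hij w w' => ?_) ?_
  · change ⟪tmul (e i) w, tmul (e j) w'⟫_ℂ = 0
    rw [inner_tmul, e.orthonormal.2 hij, zero_mul]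
  · set K := (⨆ i, LinearMap.range
      (tmulIsometry (HB := HB) (e i) (e.orthonormal.1 i)).toLinearMap).topologicalClosure with hK
    have hcl : IsClosed (K : Set (HilbertTensor HA HB)) := Submodule.isClosed_topologicalClosure _
    rintro x -
    induction x using UniformSpace.Completion.induction_on with
    | hp => exact hcl
    | ih t =>
      induction t using TensorProduct.induction_on with
      | zero =>
        rw [UniformSpace.Completion.coe_zero]
        exact K.zero_mem
      | add x y hx hy =>
        rw [UniformSpace.Completion.coe_add]
        exact K.add_mem hx hy
      | tmul a w =>
        -- Totality on a pure tensor follows by expanding `a` in the basis and applying the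
        -- continuous map `a ↦ a ⊗ w`.
        let T : HA →L[ℂ] HilbertTensor HA HB :=
          UniformSpace.Completion.toComplL ∘L (TensorProduct.mkL ℂ HA HB).flip w
        have h := (e.hasSum_repr a).mapL T
        refine hcl.mem_of_tendsto h (Filter.Eventually.of_forall fun s => ?_)
        refine K.sum_mem fun i _ => ?_
        rw [map_smul]
        refine K.smul_mem _ (Submodule.le_topologicalClosure _ ?_)
        exact Submodule.mem_iSup_of_mem i ⟨w, rfl⟩

theorem HilbertBasis.hasSum_tmul_condState {ι : Type*} (e : HilbertBasis ι ℂ HA)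
    (x : HilbertTensor HA HB) : HasSum (fun i => tmul (e i) (condState (e i) x)) x := by
  classical
  have hS := e.isHilbertSum_tmulIsometry (HB := HB)
  have h := hS.hasSum_linearIsometryEquiv_symm (hS.linearIsometryEquiv x)
  rw [LinearIsometryEquiv.symm_apply_apply] at h
  set f := hS.linearIsometryEquiv x
  change HasSum (fun i => tmul (e i) (f i)) x at h
  convert! h using 2 with i
  congr 1
  -- Conditioning on `e i` isolates the component `f i` by orthonormality.
  have h1 := h.mapL (condState (HB := HB) (e i))
  refine h1.unique ?_
  convert! hasSum_ite_eq i (f i) using 2 with j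
  rw [condState_tmul, orthonormal_iff_ite.1 e.orthonormal]
  by_cases hij : i = j
  · subst hij
    simp
  · simp [hij, Ne.symm hij]

/-- For `φ` and `ψ` this says that the diagonal of `condForm φ ψ` sums to ⟪φ, ψ⟫ in every basis. -/
theorem HilbertBasis.hasSum_inner_condState {ι : Type*} (e : HilbertBasis ι ℂ HA)
    (x y : HilbertTensor HA HB) :
    HasSum (fun i => ⟪condState (e i) x, condState (e i) y⟫_ℂ) ⟪x, y⟫_ℂ := by
  have h := (e.hasSum_tmul_condState y).mapL (innerSL ℂ x)
  convert! h using 2 with i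
  rw [← inner_conj_symm, inner_condState, inner_conj_symm]
  rfl

/-- The sesquilinear form `(a, b) ↦ ⟪φ^{|b}, ψ^{|a}⟫`. -/
noncomputable def condForm (φ ψ : HilbertTensor HA HB) : HA →ₗ⋆[ℂ] HA →ₗ[ℂ] ℂ :=
  LinearMap.mk₂'ₛₗ (starRingEnd ℂ) (RingHom.id ℂ)
    (fun a b => ⟪condState b φ, condState a ψ⟫_ℂ)
    (fun a a' b => by rw [condState_add, inner_add_right])
    (fun c a b => by rw [condState_smul, inner_smul_right, smul_eq_mul])
    (fun a b b' => by rw [condState_add, inner_add_left])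
    (fun c a b => by
      rw [condState_smul, inner_smul_left, Complex.conj_conj, smul_eq_mul, RingHom.id_apply])

end Conditional

/-! ### The discrimination protocol. -/

open HilbertTensor

theorem theorem1 {HA : Type u} {HB : Type v}
    [NormedAddCommGroup HA] [InnerProductSpace ℂ HA] [CompleteSpace HA]
    [NormedAddCommGroup HB] [InnerProductSpace ℂ HB] [CompleteSpace HB]
    (ψ φ : HilbertTensor HA HB) (hψ : ‖ψ‖ = 1) (hφ : ‖φ‖ = 1) (hψφ : ⟪ψ, φ⟫_ℂ = 0) :
    ∃ (ι : Type u) (e : HilbertBasis ι ℂ HA) (P : OneWayLOCC ι HA HB)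
      (M : HilbertTensor HA HB →L[ℂ] HilbertTensor HA HB),
      (∀ i, ⟪condState (e i) φ, condState (e i) ψ⟫_ℂ = 0) ∧
      (∀ i, P.E i = pureState (e i)) ∧
      P.HasOperator M ∧ IsBinaryDiscrimination M ∧
      PerfectlyDiscriminates M (pureState ψ) (pureState φ) := by
  obtain ⟨s, e, he⟩ := exists_hilbertBasis_apply_self_eq_zero (condForm φ ψ) fun w b => by
    have h := b.hasSum_inner_condState φ ψ
    rw [inner_eq_zero_symm.1 hψφ] at h
    exact h
  replace he : ∀ i, ⟪condState (e i) φ, condState (e i) ψ⟫_ℂ = 0 := he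
  -- Since `0⁻¹ = 0`, `u i = 0` when the conditional vector vanishes; Bob's effect is then 0, still
  -- a projection.
  set u : s → HB := fun i => ((‖condState (e i) ψ‖ : ℂ)⁻¹) • condState (e i) ψ with hu
  have hu1 : ∀ i, u i = 0 ∨ ‖u i‖ = 1 := fun i => by
    by_cases h : condState (e i) ψ = 0
    · simp [hu, h]
    · right
      simp [hu, norm_smul, h]
  have hFp : ∀ i, IsStarProjection (rankOne ℂ (u i) (u i)) := fun i => by
    rcases hu1 i with h | h
    · rw [h]
      simp
    · exact isStarProjection_rankOne_self h
  let P : OneWayLOCC s HA HB :=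
    { E := fun i => pureState (e i)
      F := fun i => rankOne ℂ (u i) (u i)
      E_nonneg := fun i => (isStarProjection_rankOne_self (e.orthonormal.1 i)).nonneg
      E_sum := fun x => by
        convert! e.hasSum_repr x using 2 with i
        simp [pureState, e.repr_apply_apply]
      F_nonneg := fun i => (hFp i).nonneg
      F_le_one := fun i => (hFp i).le_one }
  obtain ⟨M, hM, hMsum⟩ := exists_isStarProjection_hasSum_rankOne (fun i => tmul (e i) (u i))
    (fun i j hij => by
      change ⟪tmul (e i) (u i), tmul (e j) (u j)⟫_ℂ = 0
      rw [inner_tmul, e.orthonormal.2 hij, zero_mul])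
    (fun i => (hu1 i).imp (fun h => by rw [h, HilbertTensor.tmul_zero])
      fun h => by rw [HilbertTensor.norm_tmul, h, e.orthonormal.1 i, one_mul])
  have hMψ : M ψ = ψ := by
    refine (hMsum ψ).unique ?_
    -- The projection along `e i ⊗ u i` picks out of `ψ` exactly its component over `e i`, because
    -- `u i` is parallel to `condState (e i) ψ`.
    convert! e.hasSum_tmul_condState ψ using 2 with i
    rw [rankOne_apply, ← inner_condState, ← HilbertTensor.tmul_smul]
    congr 1
    by_cases h : condState (e i) ψ = 0
    · simp [h]
    · have hn : (‖condState (e i) ψ‖ : ℂ) ≠ 0 := by simpa using h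
      simp only [hu, inner_smul_left, inner_self_eq_norm_sq_to_K, smul_smul, map_inv₀,
        Complex.conj_ofReal]
      convert! one_smul ℂ _
      simp only [Complex.coe_algebraMap]
      field_simp
  have hMφ : M φ = 0 := by
    refine (hMsum φ).unique ?_
    convert! hasSum_zero using 2 with i
    rw [rankOne_apply, ← inner_condState]
    simp [hu, inner_eq_zero_symm.1 (he i)]
  refine ⟨s, e, P, M, he, fun i => rfl, fun x => ?_, ⟨hM.nonneg, hM.le_one⟩, 1, ?_, by simp⟩
  · convert! hMsum x using 2 with i
    exact DFunLike.congr_fun (tensorOp_rankOne (e i) (u i)) x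
  · have hT : M ∘L (pureState ψ - pureState φ) = pureState ψ := by
      ext x
      simp [pureState, hMψ, hMφ]
    rw [hT]
    simpa [hψ] using hasTrace_pureState ψ
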